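/- For real $\alpha$ let $\Vert\alpha\Vert$ denote the distance from $\alpha$ to the nearest integer. For an integer $k\ge 1$ and real $\lambda>0$ let $\mathscr{H}^k_\lambda$ be the set of $(\zeta_1,\dots,\zeta_k)\in\mathbb{R}^k$ such that for every $\epsilon>0$ the inequality $$\max_{1\le j\le k}\Vert q\zeta_j\Vert\le q^{-\lambda+\epsilon}$$ holds for infinitely many positive integers $q$. Let $k\ge 1$ be an integer, let $P_1(X)=X$ and $P_2,\dots,P_k\in\mathbb{Q}[X]$ be polynomials whose degrees $d_j=\deg P_j$ satisfy $1=d_1\le d_2\le\dots\le d_k$, and let $$\mathscr{C}=\{(x,P_2(x),\dots,P_k(x)) : x\in\mathbb{R}\}\subseteq\mathbb{R}^k.$$ Let $t=\max_{1\le j\le k-1}(d_{j+1}-d_j)$ (with $t=0$ if $k=1$) and assume $t\ge 1$. Then for every real $\lambda>t$ the Hausdorff dimension of $\mathscr{C}\cap\mathscr{H}^k_\lambda$ satisfies $$\dim(\mathscr{C}\cap\mathscr{H}^k_\lambda)=\frac{2}{d_k(\lambda+1)}.$$ -/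

import Mathlib

open Polynomial

namespace PolyCurve

/-- The distance of a real number to the nearest integer. -/
noncomputable def distNearestInt (α : ℝ) : ℝ := |α - round α|

/-- The set of `ζ ∈ ℝ^k` such that, for every `ε > 0`, the estimate
`max_j ‖q ζ_j‖ ≤ q ^ (-lam + ε)` has infinitely many positive integer solutions `q`. -/
def simApprox (k : ℕ) (lam : ℝ) : Set (EuclideanSpace ℝ (Fin k)) :=
  {ζ | ∀ ε : ℝ, 0 < ε →
    {q : ℕ | 0 < q ∧ ∀ j : Fin k, distNearestInt ((q : ℝ) * ζ j) ≤ (q : ℝ) ^ (-lam + ε)}.Infinite}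

/-- The curve `{(P_1(x), …, P_k(x)) : x ∈ ℝ}` in Euclidean space `ℝ^k`. -/
noncomputable def curve {k : ℕ} (P : Fin k → ℚ[X]) : Set (EuclideanSpace ℝ (Fin k)) :=
  Set.range fun x : ℝ => WithLp.toLp 2 fun j : Fin k => aeval x (P j)

/-- The type of the curve: the tuple of degrees `d_j = deg P_j`. -/
noncomputable def type {k : ℕ} (P : Fin k → ℚ[X]) : Fin k → ℕ := fun j => (P j).natDegree

/-- The diameter `max_j (d_{j+1} - d_j)` of a curve given by `k = n + 1` polynomials whose degrees
are non-decreasing (so the subtraction does not truncate); it is `0` when there is only one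
polynomial. -/
noncomputable def diameter {n : ℕ} (P : Fin (n + 1) → ℚ[X]) : ℕ :=
  Finset.univ.sup fun j : Fin n => type P j.succ - type P j.castSucc

end PolyCurve

/-!
The map `x ↦ (P_1(x), …, P_k(x))` is locally Lipschitz and its first coordinate is `x`, so the
dimension is that of the set of parameters `x`. Up to rational `x`, which do not matter, this set
is compared with sets of reals approximable by infinitely many rationals `r` to within
`r.den ^ (-τ)`, whose dimension is `2 / τ` for `τ > 2` by the theorem of Jarník and Besicovitch.
Write `d` for the largest degree; the relevant exponent is `τ = d * (lam + 1)`.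

*From the curve to the parameter* (`mem_approxSet_of_curvePoint_mem`). Let `q` be a good
simultaneous denominator and `r = p / q` the resulting approximation of `x`, in lowest terms with
denominator `b`. Then every `q * P_j(r)` is very close to an integer. If `q * P_j(r)` is an integer,
then `b ^ d_j` divides `q` up to a bounded factor (`exists_den_pow_dvd`), so `q * P_{j+1}(r)` has
denominator `O(b ^ t) = O(q ^ t)`; as `lam > t`, being so close to an integer it is one
(`exists_int_eq_mul_eval`). Inductively `b ^ d = O(q)`, and
`|x - r| ≤ q ^ (-lam - 1 + ε)` becomes an approximation of exponent almost `d * (lam + 1)`.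

*From the parameter to the curve* (`curvePoint_mem_simApprox`). Conversely, a rational `r` within
`b ^ (-d * (lam + 1))` of `x` gives the simultaneous denominator `q = D * b ^ d`, where `D` is a
common denominator of the coefficients.

*Upper bound for the dimension* (`dimH_approxSet_le`). This is the Borel–Cantelli argument: the sum
of `b ^ (-τ * s)` over the rationals in a bounded interval converges for `τ * s > 2`.

*Lower bound for the dimension* (`le_dimH_approxSet`). An interval of length `ℓ` contains at least
`ℓ N² / 16` rationals of denominator at most `N` once `N` is large
(`eventually_le_card_boundedFractions`), and these are `N⁻²`-separated. Placing short intervals at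
such rationals, with `N` growing fast from level to level, gives a Cantor set of well approximable
numbers. In place of a mass distribution, it is parametrized by `[0, 1)`; the inverse of the
parametrization is Hölder continuous of any exponent `s < 2 / τ` (`sub_le_rpow_cantorPoint`), and it
maps the Cantor set onto a set of dimension one.
-/

namespace PolyCurve
open Filter MeasureTheory Topology ENNReal

/-! ### Denominators of values of rational polynomials -/

/-- Clearing denominators of the coefficients. -/
theorem exists_int_polynomial_multiple (P : ℚ[X]) :
    ∃ D : ℤ, D ≠ 0 ∧ ∃ F : ℤ[X], F.natDegree = P.natDegree ∧
      ∀ r : ℚ, F.eval₂ (Int.castRingHom ℚ) r = D * P.eval r := by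
  obtain ⟨D, hD, hF⟩ := IsLocalization.integerNormalization_spec (nonZeroDivisors ℤ) P
  have hD0 : D ≠ 0 := nonZeroDivisors.ne_zero hD
  have hDQ : (D : ℚ) ≠ 0 := by exact_mod_cast hD0
  have hsmul : D • P = C (D : ℚ) * P := by
    ext i; simp
  refine ⟨D, hD0, IsLocalization.integerNormalization (nonZeroDivisors ℤ) P, ?_, fun r => ?_⟩
  · rw [← natDegree_map_eq_of_injective (f := algebraMap ℤ ℚ) Int.cast_injective, hF, hsmul,
      natDegree_C_mul hDQ]
  · have := congrArg (eval r) hF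
    rw [hsmul, eval_mul, eval_C, eval_map] at this
    exact this

/-- The homogenization of an integer polynomial takes integer values. -/
theorem exists_int_eq_den_pow_mul_eval₂ (F : ℤ[X]) (r : ℚ) :
    (r.den : ℚ) ^ F.natDegree * F.eval₂ (Int.castRingHom ℚ) r =
      ((F.scaleRoots (r.den : ℤ)).eval r.num : ℤ) := by
  have h := scaleRoots_eval₂_mul (p := F) (Int.castRingHom ℚ) r (r.den : ℤ)
  have h2 : (Int.castRingHom ℚ) (r.den : ℤ) * r = (Int.castRingHom ℚ) r.num := by
    simp [Rat.den_mul_eq_num]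
  rw [h2, eval₂_at_apply] at h
  simpa using h.symm

/-- Up to a bounded factor, the denominator of `P(r)` divides `r.den ^ deg P`. -/
theorem exists_denominator_multiple (P : ℚ[X]) :
    ∃ D : ℕ, 0 < D ∧ ∀ r : ℚ, ∃ z : ℤ, (D : ℚ) * (r.den : ℚ) ^ P.natDegree * P.eval r = z := by
  obtain ⟨D, hD, F, hF, hFr⟩ := exists_int_polynomial_multiple P
  refine ⟨D.natAbs, Int.natAbs_pos.2 hD, fun r => ?_⟩
  have h := exists_int_eq_den_pow_mul_eval₂ F r
  rw [hFr, hF] at h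
  rcases Int.natAbs_eq D with h' | h'
  · refine ⟨(F.scaleRoots (r.den : ℤ)).eval r.num, ?_⟩
    rw [← h]
    have : ((D.natAbs : ℕ) : ℚ) = D := by
      conv_rhs => rw [h']
      simp
    rw [this]; ring
  · refine ⟨-(F.scaleRoots (r.den : ℤ)).eval r.num, ?_⟩
    rw [Int.cast_neg, ← h]
    have : ((D.natAbs : ℕ) : ℚ) = -D := by
      conv_rhs => rw [h']
      simp
    rw [this]; ring

theorem isCoprime_eval_scaleRoots {G : ℤ[X]} (hG : G.Monic) {a b : ℤ} (hab : IsCoprime a b) :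
    IsCoprime ((G.scaleRoots b).eval a) b := by
  have h : ∃ c : ℤ, (G.scaleRoots b).eval a = a ^ G.natDegree + b * c := by
    rw [eval_eq_sum_range, natDegree_scaleRoots, Finset.sum_range_succ]
    have h1 : b ∣ ∑ i ∈ Finset.range G.natDegree, (G.scaleRoots b).coeff i * a ^ i := by
      refine Finset.dvd_sum fun i hi => Dvd.dvd.mul_right ?_ _
      rw [coeff_scaleRoots]
      exact Dvd.dvd.mul_left (dvd_pow_self _ (by have := Finset.mem_range.1 hi; omega)) _
    obtain ⟨c, hc⟩ := h1
    refine ⟨c, ?_⟩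
    rw [hc, coeff_scaleRoots, hG.coeff_natDegree]
    simp [add_comm]
  obtain ⟨c, hc⟩ := h
  rw [hc]
  exact (IsCoprime.pow_left hab).add_mul_left_left c

/-- For a monic integer polynomial `G` the denominator of `G(y)` is exactly `y.den ^ deg G`. -/
theorem den_pow_dvd_of_monic {G : ℤ[X]} (hG : G.Monic) (y : ℚ) (q z : ℤ)
    (h : (q : ℚ) * G.eval₂ (Int.castRingHom ℚ) y = z) :
    (y.den : ℤ) ^ G.natDegree ∣ q := by
  have hc : IsCoprime (y.den ^ G.natDegree : ℤ) ((G.scaleRoots (y.den : ℤ)).eval y.num) := by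
    refine IsCoprime.pow_left (isCoprime_eval_scaleRoots hG ?_).symm
    rw [Int.isCoprime_iff_gcd_eq_one]
    exact y.reduced
  refine hc.dvd_of_dvd_mul_right (Dvd.intro z ?_)
  have h1 := exists_int_eq_den_pow_mul_eval₂ G y
  have : ((y.den ^ G.natDegree * z : ℤ) : ℚ) =
      ((q * (G.scaleRoots (y.den : ℤ)).eval y.num : ℤ) : ℚ) := by
    rw [Int.cast_mul q, ← h1, Int.cast_mul, ← h]
    push_cast
    ring
  exact_mod_cast this

/-- Up to a bounded factor, `r.den ^ deg P` divides the denominator of `P(r)`. -/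
theorem exists_den_pow_dvd (P : ℚ[X]) (hP : 1 ≤ P.natDegree) :
    ∃ B : ℕ, 0 < B ∧ ∀ (r : ℚ) (q : ℕ), (∃ z : ℤ, (q : ℚ) * P.eval r = z) →
      r.den ^ P.natDegree ∣ B * q := by
  obtain ⟨D, hD, F, hF, hFr⟩ := exists_int_polynomial_multiple P
  have hF0 : F ≠ 0 := by rintro rfl; simp at hF; omega
  set A := F.leadingCoeff with hA
  have hA0 : A ≠ 0 := leadingCoeff_ne_zero.2 hF0
  refine ⟨A.natAbs ^ P.natDegree, pow_pos (Int.natAbs_pos.2 hA0) _, ?_⟩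
  rintro r q ⟨z, hz⟩
  -- `A ^ (d - 1) * F(X) = G(A * X)` with `G` monic
  have hG := integralNormalization_eval₂_leadingCoeff_mul (p := F) (hF ▸ hP) (Int.castRingHom ℚ) r
  have h1 := den_pow_dvd_of_monic (monic_integralNormalization hF0) ((A : ℚ) * r) q
    (A ^ (F.natDegree - 1) * D * z) (by
      have hG' : eval₂ (Int.castRingHom ℚ) ((A : ℚ) * r) F.integralNormalization =
        (A : ℚ) ^ (F.natDegree - 1) * F.eval₂ (Int.castRingHom ℚ) r := hG
      rw [hG', hFr]
      push_cast
      rw [← hz]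
      ring)
  rw [natDegree_integralNormalization, hF] at h1
  have h2 : (r.den : ℤ) ∣ A * ((A : ℚ) * r).den := by
    have h3 : r = Rat.divInt ((A : ℚ) * r).num (A * ((A : ℚ) * r).den) := by
      rw [Rat.divInt_eq_div]
      have hAQ : (A : ℚ) ≠ 0 := by exact_mod_cast hA0
      have h4 := Rat.mul_den_eq_num ((A : ℚ) * r)
      have h5 : (((A : ℚ) * r).den : ℚ) ≠ 0 := by exact_mod_cast ((A : ℚ) * r).den_nz
      rw [eq_div_iff (by push_cast; exact mul_ne_zero hAQ h5), ← h4]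
      push_cast
      ring
    conv_lhs => rw [h3]
    exact Rat.den_dvd _ _
  have h6 : (r.den : ℤ) ^ P.natDegree ∣ A ^ P.natDegree * q :=
    (pow_dvd_pow_of_dvd h2 _).trans (by rw [mul_pow]; exact mul_dvd_mul_left _ h1)
  have h7 := Int.natAbs_dvd_natAbs.2 h6
  simpa [Int.natAbs_mul, Int.natAbs_pow] using h7

/-! ### The upper bound for the dimension of well approximable numbers -/

/-- A Borel–Cantelli lemma for Hausdorff measures. -/
theorem hausdorffMeasure_limsup_eq_zero {X ι : Type*} [MetricSpace X] [MeasurableSpace X]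
    [BorelSpace X] [Countable ι] (t : ι → Set X) {s : ℝ} (hs : 0 < s)
    (ht : ∑' i, Metric.ediam (t i) ^ s ≠ ∞) :
    μH[s] {x | {i | x ∈ t i}.Infinite} = 0 := by
  have htail := ENNReal.tendsto_tsum_compl_atTop_zero ht
  have hr : Tendsto (fun S : Finset ι => (∑' i : {i // i ∉ S}, Metric.ediam (t i) ^ s) ^ s⁻¹)
      atTop (𝓝 0) := by
    have := (ENNReal.continuous_rpow_const (y := s⁻¹)).tendsto 0 |>.comp htail
    rwa [ENNReal.zero_rpow_of_pos (inv_pos.2 hs)] at this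
  have h := Measure.hausdorffMeasure_le_liminf_tsum (ι := fun S : Finset ι => {i // i ∉ S}) s
    {x | {i | x ∈ t i}.Infinite} _ hr (fun S i => t i)
    (Eventually.of_forall fun S i => by
      rw [ENNReal.le_rpow_inv_iff hs]
      exact ENNReal.le_tsum (f := fun i : {i // i ∉ S} => Metric.ediam (t i) ^ s) i)
    (Eventually.of_forall fun S x hx => by
      obtain ⟨i, hi, hiS⟩ := hx.exists_notMem_finset S
      exact Set.mem_iUnion.2 ⟨⟨i, hiS⟩, hi⟩)
  rw [htail.liminf_eq] at h
  exact le_antisymm h bot_le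

/-- The reals which are approximable by rationals `r` to within `C * r.den ^ (-τ)`, in the sense
that such approximations are found arbitrarily close. For `C, τ > 0` every rational number belongs
to this set, and an irrational number does if and only if it has infinitely many such
approximations. -/
def approxSet (C τ : ℝ) : Set ℝ :=
  {x | ∀ δ : ℝ, 0 < δ → ∃ r : ℚ, |x - r| ≤ δ ∧ |x - r| ≤ C * (r.den : ℝ) ^ (-τ)}

theorem infinite_of_mem_approxSet {C τ x : ℝ} (hx : x ∈ approxSet C τ) (hirr : Irrational x)
    {K : ℝ} (hK : |x| < K) :
    {r : ℚ | |(r : ℝ)| ≤ K ∧ |x - r| ≤ C * (r.den : ℝ) ^ (-τ)}.Infinite := by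
  intro hfin
  have hpos : ∀ r : ℚ, 0 < |x - r| := fun r => abs_pos.2 (sub_ne_zero.2 (hirr.ne_rat r))
  obtain ⟨δ, hδ, hδr⟩ : ∃ δ > 0, ∀ r ∈ {r : ℚ | |(r : ℝ)| ≤ K ∧ |x - r| ≤ C * (r.den : ℝ) ^ (-τ)},
      δ < |x - r| := by
    have h : ∀ᶠ δ : ℝ in 𝓝[>] 0, ∀ r ∈ {r : ℚ | |(r : ℝ)| ≤ K ∧
        |x - r| ≤ C * (r.den : ℝ) ^ (-τ)}, δ < |x - r| :=
      (hfin.eventually_all).2 fun r _ =>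
        nhdsWithin_le_nhds (eventually_lt_nhds (hpos r))
    obtain ⟨δ, h1, h2⟩ := (h.and self_mem_nhdsWithin).exists
    exact ⟨δ, h2, h1⟩
  obtain ⟨r, h1, h2⟩ := hx (min δ (K - |x|)) (lt_min hδ (sub_pos.2 hK))
  have h3 : |(r : ℝ)| ≤ K := by
    have h4 := abs_sub_abs_le_abs_sub (r : ℝ) x
    rw [abs_sub_comm] at h4
    linarith [h1.trans (min_le_right _ _)]
  exact absurd (hδr r ⟨h3, h2⟩) (not_lt.2 (h1.trans (min_le_left _ _)))

/-- `∑ den ^ (-u)` over the rationals in a bounded interval converges for `u > 2`, as there are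
`O(b)` fractions with denominator `b`. -/
theorem tsum_den_rpow_ne_top (K : ℕ) {u : ℝ} (hu : 2 < u) :
    ∑' r : {r : ℚ // |(r : ℝ)| ≤ K}, ENNReal.ofReal ((r.1.den : ℝ) ^ (-u)) ≠ ∞ := by
  let φ : {r : ℚ // |(r : ℝ)| ≤ K} → (Σ b : ℕ, Finset.Icc (-(K * b : ℤ)) (K * b)) := fun r =>
    ⟨r.1.den, r.1.num, by
      have hden : (0 : ℝ) < r.1.den := by exact_mod_cast r.1.den_pos
      have h1 : |(r.1.num : ℝ)| ≤ K * r.1.den := by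
        have h2 : (r.1.num : ℝ) = (r.1 : ℝ) * r.1.den := by
          exact_mod_cast (Rat.mul_den_eq_num r.1).symm
        rw [h2, abs_mul, abs_of_pos hden]
        exact mul_le_mul_of_nonneg_right r.2 hden.le
      rw [Finset.mem_Icc, ← abs_le]
      exact_mod_cast h1⟩
  have hφ : Function.Injective φ := by
    intro r r' h
    have h1 : r.1.den = r'.1.den := congrArg Sigma.fst h
    have h2 : r.1.num = r'.1.num :=
      congrArg (fun p : (Σ b : ℕ, Finset.Icc (-(K * b : ℤ)) (K * b)) => (p.2 : ℤ)) h
    exact Subtype.ext (Rat.ext h2 h1)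
  have hle : ∑' r : {r : ℚ // |(r : ℝ)| ≤ K}, ENNReal.ofReal ((r.1.den : ℝ) ^ (-u)) ≤
      ∑' p : (Σ b : ℕ, Finset.Icc (-(K * b : ℤ)) (K * b)), ENNReal.ofReal ((p.1 : ℝ) ^ (-u)) :=
    ENNReal.tsum_comp_le_tsum_of_injective hφ fun p => ENNReal.ofReal ((p.1 : ℝ) ^ (-u))
  refine ne_top_of_le_ne_top ?_ hle
  rw [ENNReal.tsum_sigma']
  have hterm : ∀ b : ℕ, ∑' _ : Finset.Icc (-(K * b : ℤ)) (K * b), ENNReal.ofReal ((b : ℝ) ^ (-u)) ≤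
      ENNReal.ofReal ((2 * K + 1) * (b : ℝ) ^ (-(u - 1))) := by
    intro b
    rcases Nat.eq_zero_or_pos b with rfl | hb
    · rw [tsum_fintype]
      simp [Real.zero_rpow (show -u ≠ 0 by linarith)]
    have hb' : (1 : ℝ) ≤ b := by exact_mod_cast hb
    rw [tsum_fintype, Finset.sum_const, nsmul_eq_mul, ← ENNReal.ofReal_natCast,
      ← ENNReal.ofReal_mul (by positivity)]
    refine ENNReal.ofReal_le_ofReal ?_
    have hcard : ((Finset.univ : Finset (Finset.Icc (-(K * b : ℤ)) (K * b))).card : ℝ) ≤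
        (2 * K + 1) * b := by
      rw [Finset.card_univ, Fintype.card_coe, Int.card_Icc]
      have : ((K * b + 1 - -(K * b) : ℤ).toNat : ℤ) = 2 * (K * b) + 1 := by
        rw [Int.toNat_of_nonneg (by have : (0 : ℤ) ≤ K * b := by positivity
                                    linarith)]; ring
      have : (((K * b + 1 - -(K * b) : ℤ).toNat : ℕ) : ℝ) = 2 * (K * b) + 1 := by
        exact_mod_cast this
      rw [this]
      linarith
    have hsplit : (b : ℝ) ^ (-(u - 1)) = b * (b : ℝ) ^ (-u) := by
      rw [← Real.rpow_one_add' (by positivity) (by linarith)]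
      congr 1; ring
    rw [hsplit, ← mul_assoc]
    exact mul_le_mul_of_nonneg_right hcard (by positivity)
  refine ne_top_of_le_ne_top ?_ (ENNReal.tsum_le_tsum hterm)
  have hsum : Summable fun b : ℕ => (2 * K + 1) * (b : ℝ) ^ (-(u - 1)) :=
    (Real.summable_nat_rpow.2 (by linarith)).mul_left _
  rw [← ENNReal.ofReal_tsum_of_nonneg (fun b => by positivity) hsum]
  exact ENNReal.ofReal_ne_top

theorem dimH_approxSet_le {C τ : ℝ} (hC : 0 < C) (hτ : 0 < τ) :
    dimH (approxSet C τ) ≤ ENNReal.ofReal (2 / τ) := by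
  have hcover : approxSet C τ ⊆ Set.range ((↑) : ℚ → ℝ) ∪ ⋃ K : ℕ,
      {x | {r : {r : ℚ // |(r : ℝ)| ≤ K} | x ∈ Metric.closedBall (r.1 : ℝ)
        (C * (r.1.den : ℝ) ^ (-τ))}.Infinite} := by
    intro x hx
    by_cases hirr : Irrational x
    · right
      obtain ⟨K, hK⟩ := exists_nat_gt |x|
      refine Set.mem_iUnion.2 ⟨K, ?_⟩
      have h := infinite_of_mem_approxSet hx hirr hK
      intro hfin
      refine h ((hfin.image Subtype.val).subset ?_)
      rintro r ⟨h1, h2⟩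
      exact ⟨⟨r, h1⟩, by simpa [Real.dist_eq] using h2, rfl⟩
    · left
      simpa [Irrational] using hirr
  refine (dimH_mono hcover).trans ?_
  rw [dimH_union, dimH_countable (Set.countable_range _), dimH_iUnion]
  refine max_le bot_le (iSup_le fun K => ?_)
  refine dimH_le fun s hs => ?_
  by_contra hlt
  have h2s : 2 / τ < s := by
    rw [not_le, ← ENNReal.ofReal_coe_nnreal] at hlt
    exact (ENNReal.ofReal_lt_ofReal_iff_of_nonneg (by positivity)).1 hlt
  have hs0 : (0 : ℝ) < s := lt_trans (by positivity) h2s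
  have hu : 2 < τ * s := by rwa [div_lt_iff₀' hτ] at h2s
  have hzero := hausdorffMeasure_limsup_eq_zero (fun r : {r : ℚ // |(r : ℝ)| ≤ K} =>
    Metric.closedBall (r.1 : ℝ) (C * (r.1.den : ℝ) ^ (-τ))) hs0 (by
      have hterm : ∀ r : {r : ℚ // |(r : ℝ)| ≤ K},
          Metric.ediam (Metric.closedBall (r.1 : ℝ) (C * (r.1.den : ℝ) ^ (-τ))) ^ (s : ℝ) =
          ENNReal.ofReal ((2 * C) ^ (s : ℝ)) * ENNReal.ofReal ((r.1.den : ℝ) ^ (-(τ * s))) := by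
        intro r
        rw [Real.closedBall_eq_Icc, Real.ediam_Icc,
          ENNReal.ofReal_rpow_of_nonneg (by ring_nf; positivity) hs0.le,
          ← ENNReal.ofReal_mul (by positivity), ← neg_mul, Real.rpow_mul (by positivity),
          ← Real.mul_rpow (by positivity) (by positivity)]
        ring_nf
      simp_rw [hterm]
      rw [ENNReal.tsum_mul_left]
      exact ENNReal.mul_ne_top ENNReal.ofReal_ne_top (tsum_den_rpow_ne_top K hu))
  rw [hs] at hzero
  exact ENNReal.top_ne_zero hzero

/-! ### Counting rationals in an interval -/

/-- The pairs `(b, a)` with `1 ≤ b ≤ N` and `x ≤ a / b ≤ x + ℓ`, coprime or not. -/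
noncomputable def fractionPairs (x ℓ : ℝ) (N : ℕ) : Finset (Σ _ : ℕ, ℤ) :=
  (Finset.Icc 1 N).sigma fun b => Finset.Icc ⌈x * b⌉ ⌊(x + ℓ) * b⌋

/-- The rationals of denominator at most `N` in `[x, x + ℓ]`. -/
noncomputable def boundedFractions (x ℓ : ℝ) (N : ℕ) : Finset ℚ :=
  (fractionPairs x ℓ N).image fun p => (p.2 : ℚ) / p.1

theorem mem_fractionPairs {x ℓ : ℝ} {N : ℕ} {p : Σ _ : ℕ, ℤ} :
    p ∈ fractionPairs x ℓ N ↔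
      (1 ≤ p.1 ∧ p.1 ≤ N) ∧ x ≤ (p.2 : ℝ) / p.1 ∧ (p.2 : ℝ) / p.1 ≤ x + ℓ := by
  rw [fractionPairs, Finset.mem_sigma, Finset.mem_Icc, Finset.mem_Icc, Int.ceil_le, Int.le_floor]
  refine and_congr_right fun h => ?_
  have : (0 : ℝ) < p.1 := by exact_mod_cast h.1
  rw [le_div_iff₀ this, div_le_iff₀ this]

theorem mem_boundedFractions {x ℓ : ℝ} {N : ℕ} {r : ℚ} :
    r ∈ boundedFractions x ℓ N ↔ r.den ≤ N ∧ x ≤ r ∧ (r : ℝ) ≤ x + ℓ := by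
  rw [boundedFractions, Finset.mem_image]
  constructor
  · rintro ⟨⟨b, a⟩, hp, rfl⟩
    obtain ⟨⟨h1, h2⟩, h3⟩ := mem_fractionPairs.1 hp
    refine ⟨?_, by simpa using h3⟩
    have h4 := Rat.den_dvd a b
    rw [Rat.divInt_eq_div] at h4
    exact (Nat.le_of_dvd h1 (by exact_mod_cast h4)).trans h2
  · rintro ⟨h1, h2⟩
    refine ⟨⟨r.den, r.num⟩, mem_fractionPairs.2 ⟨⟨r.den_pos, h1⟩, ?_⟩, r.num_div_den⟩
    rwa [← Rat.cast_def]

theorem card_fractionPairs_le {x ℓ : ℝ} (hℓ : 0 ≤ ℓ) (N : ℕ) :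
    ((fractionPairs x ℓ N).card : ℝ) ≤ ℓ * (N * (N + 1) / 2) + N := by
  have h : ∀ b : ℕ, ((Finset.Icc ⌈x * b⌉ ⌊(x + ℓ) * b⌋).card : ℝ) ≤ ℓ * b + 1 := by
    intro b
    rw [Int.card_Icc]
    have h1 := Int.floor_le ((x + ℓ) * b)
    have h2 := Int.le_ceil (x * b)
    have h3 : (0 : ℝ) ≤ ℓ * b := by positivity
    have h4 : (((⌊(x + ℓ) * b⌋ + 1 - ⌈x * b⌉).toNat : ℤ) : ℝ) ≤ ℓ * b + 1 := by
      rw [Int.ofNat_toNat]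
      push_cast
      exact max_le (by linarith) (by linarith)
    exact_mod_cast h4
  rw [fractionPairs, Finset.card_sigma]
  push_cast
  refine (Finset.sum_le_sum fun b _ => h b).trans (le_of_eq ?_)
  induction N with
  | zero => simp
  | succ n ih => rw [Finset.sum_Icc_succ_top (by omega), ih]; push_cast; ring

theorem le_card_fractionPairs (x ℓ : ℝ) (N : ℕ) :
    ℓ * (N * (N + 1) / 2) - N ≤ ((fractionPairs x ℓ N).card : ℝ) := by
  have h : ∀ b : ℕ, ℓ * b - 1 ≤ ((Finset.Icc ⌈x * b⌉ ⌊(x + ℓ) * b⌋).card : ℝ) := by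
    intro b
    rw [Int.card_Icc]
    have h1 := Int.lt_floor_add_one ((x + ℓ) * b)
    have h2 := Int.ceil_lt_add_one (x * b)
    have h4 : ℓ * b - 1 ≤ (((⌊(x + ℓ) * b⌋ + 1 - ⌈x * b⌉).toNat : ℤ) : ℝ) := by
      rw [Int.ofNat_toNat]
      push_cast
      exact le_max_of_le_left (by linarith)
    exact_mod_cast h4
  rw [fractionPairs, Finset.card_sigma]
  push_cast
  refine le_trans (le_of_eq ?_) (Finset.sum_le_sum fun b _ => h b)
  induction N with
  | zero => simp
  | succ n ih => rw [Finset.sum_Icc_succ_top (by omega), ← ih]; push_cast; ring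

/-- Sorting the pairs `(b, a)` by their greatest common divisor `g`. -/
theorem card_fractionPairs_le_sum (x ℓ : ℝ) (N : ℕ) :
    (fractionPairs x ℓ N).card ≤ ∑ g ∈ Finset.Icc 1 N, (boundedFractions x ℓ (N / g)).card := by
  classical
  have hsub : fractionPairs x ℓ N ⊆ (Finset.Icc 1 N).biUnion fun g =>
      (boundedFractions x ℓ (N / g)).image fun r => ⟨g * r.den, g * r.num⟩ := by
    rintro ⟨b, a⟩ hp
    obtain ⟨⟨h1, h2⟩, h3⟩ := mem_fractionPairs.1 hp
    simp only at h1 h2 h3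
    set r : ℚ := (a : ℚ) / b with hr
    have h4 : (r.den : ℤ) ∣ b := by
      have := Rat.den_dvd a b
      rwa [Rat.divInt_eq_div, Int.cast_natCast] at this
    obtain ⟨g, hg⟩ : r.den ∣ b := by exact_mod_cast h4
    have hg0 : 0 < g := Nat.pos_of_ne_zero (by rintro rfl; omega)
    have hgb : g ≤ b := hg ▸ Nat.le_mul_of_pos_left g r.den_pos
    have ha : a = g * r.num := by
      have hb : (b : ℚ) ≠ 0 := by exact_mod_cast (show b ≠ 0 by omega)
      have h5 : (a : ℚ) = r * b := by rw [hr]; field_simp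
      have h6 : (b : ℚ) = r.den * g := by exact_mod_cast hg
      have h7 : (a : ℚ) = g * r.num := by
        rw [h5, h6, ← mul_assoc, Rat.mul_den_eq_num, mul_comm]
      exact_mod_cast h7
    refine Finset.mem_biUnion.2 ⟨g, Finset.mem_Icc.2 ⟨hg0, hgb.trans h2⟩,
      Finset.mem_image.2 ⟨r, mem_boundedFractions.2 ⟨?_, ?_⟩, ?_⟩⟩
    · rw [Nat.le_div_iff_mul_le hg0]; omega
    · rw [hr]; push_cast; exact h3
    · rw [← ha, mul_comm, ← hg]
  exact (Finset.card_le_card hsub).trans (Finset.card_biUnion_le.trans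
    (Finset.sum_le_sum fun g _ => Finset.card_image_le))

theorem sum_inv_sq_le (N : ℕ) : ∑ g ∈ Finset.Icc 2 N, ((g : ℝ) ^ 2)⁻¹ ≤ 3 / 4 := by
  rcases Nat.lt_or_ge N 2 with h | h
  · rw [Finset.Icc_eq_empty (by omega)]; norm_num
  have key : ∑ g ∈ Finset.Icc 2 N, ((g : ℝ) ^ 2)⁻¹ ≤ 3 / 4 - 1 / N := by
    induction N, h using Nat.le_induction with
    | base => norm_num
    | succ n hn ih =>
      rw [Finset.sum_Icc_succ_top (by omega)]
      have hn0 : (0 : ℝ) < n := by exact_mod_cast (show 0 < n by omega)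
      have : (((n + 1 : ℕ) : ℝ) ^ 2)⁻¹ ≤ 1 / n - 1 / ((n + 1 : ℕ) : ℝ) := by
        push_cast
        rw [div_sub_div _ _ hn0.ne' (by positivity), inv_eq_one_div,
          div_le_div_iff₀ (by positivity) (by positivity)]
        nlinarith
      linarith
  have : (0 : ℝ) ≤ 1 / N := by positivity
  linarith

theorem sum_inv_le (N : ℕ) : ∑ g ∈ Finset.Icc 2 N, (g : ℝ)⁻¹ ≤ 1 + Real.log N := by
  have h := harmonic_le_one_add_log N
  rw [harmonic_eq_sum_Icc] at h
  push_cast at h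
  refine le_trans (Finset.sum_le_sum_of_subset_of_nonneg
    (Finset.Icc_subset_Icc_left (by norm_num)) fun _ _ _ => by positivity) h

/-- Since `∑_{g ≥ 2} g⁻² < 1`, a positive proportion of the pairs is coprime. -/
theorem le_card_boundedFractions {ℓ : ℝ} (hℓ : 0 ≤ ℓ) (x : ℝ) {N : ℕ} (hN : 1 ≤ N) :
    ℓ * N ^ 2 / 8 - N - (ℓ / 2 + 1) * N * (1 + Real.log N) ≤
      ((boundedFractions x ℓ N).card : ℝ) := by
  have h1 := card_fractionPairs_le_sum x ℓ N
  rw [← Finset.sum_Ioc_add_eq_sum_Icc hN, Nat.div_one] at h1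
  have hIoc : Finset.Ioc 1 N = Finset.Icc 2 N := by ext; simp; omega
  rw [hIoc] at h1
  have h2 : ((fractionPairs x ℓ N).card : ℝ) ≤
      ∑ g ∈ Finset.Icc 2 N, ((boundedFractions x ℓ (N / g)).card : ℝ) +
        (boundedFractions x ℓ N).card := by exact_mod_cast h1
  have h3 : ∀ g ∈ Finset.Icc 2 N, ((boundedFractions x ℓ (N / g)).card : ℝ) ≤
      ℓ * N ^ 2 / 2 * ((g : ℝ) ^ 2)⁻¹ + (ℓ / 2 + 1) * N * (g : ℝ)⁻¹ := by
    intro g hg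
    have hg0 : (0 : ℝ) < g := by exact_mod_cast (by have := Finset.mem_Icc.1 hg; omega : 0 < g)
    have h4 : ((boundedFractions x ℓ (N / g)).card : ℝ) ≤ (fractionPairs x ℓ (N / g)).card := by
      exact_mod_cast Finset.card_image_le
    refine h4.trans ((card_fractionPairs_le hℓ _).trans ?_)
    have h5 : ((N / g : ℕ) : ℝ) ≤ N / g := Nat.cast_div_le
    have h6 : ℓ * (((N / g : ℕ) : ℝ) * (((N / g : ℕ) : ℝ) + 1) / 2) + ((N / g : ℕ) : ℝ) ≤
        ℓ * ((N / g : ℝ) * ((N / g : ℝ) + 1) / 2) + (N / g : ℝ) := by gcongr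
    refine h6.trans (le_of_eq ?_)
    field_simp
    ring
  have h7 := Finset.sum_le_sum h3
  rw [Finset.sum_add_distrib, ← Finset.mul_sum, ← Finset.mul_sum] at h7
  have h8 := mul_le_mul_of_nonneg_left (sum_inv_sq_le N) (show 0 ≤ ℓ * N ^ 2 / 2 by positivity)
  have h9 := mul_le_mul_of_nonneg_left (sum_inv_le N) (show 0 ≤ (ℓ / 2 + 1) * N by positivity)
  have h10 := le_card_fractionPairs x ℓ N
  have h11 : 0 ≤ ℓ * N := by positivity
  nlinarith

/-- An interval of length `ℓ` contains at least `ℓ N² / 16` rationals of denominator at most `N`,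
for all large `N`, uniformly in the position of the interval. -/
theorem eventually_le_card_boundedFractions {ℓ : ℝ} (hℓ : 0 < ℓ) :
    ∀ᶠ N : ℕ in atTop, ∀ x : ℝ, ℓ / 16 * N ^ 2 ≤ ((boundedFractions x ℓ N).card : ℝ) := by
  have hlog : Tendsto (fun N : ℕ => (1 + (ℓ / 2 + 1) + (ℓ / 2 + 1) * Real.log N) / N) atTop
      (𝓝 0) := by
    have h1 : Tendsto (fun y : ℝ => Real.log y / y) atTop (𝓝 0) :=
      Real.isLittleO_log_id_atTop.tendsto_div_nhds_zero
    have h2 := ((tendsto_const_div_atTop_nhds_zero_nat (1 + (ℓ / 2 + 1))).add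
      ((h1.comp tendsto_natCast_atTop_atTop).const_mul (ℓ / 2 + 1)))
    rw [mul_zero, add_zero] at h2
    refine h2.congr fun N => ?_
    simp only [Function.comp]
    ring
  filter_upwards [hlog.eventually_le_const (show 0 < ℓ / 16 by positivity), eventually_ge_atTop 1]
    with N h1 hN x
  have hN0 : (0 : ℝ) < N := by exact_mod_cast hN
  rw [div_le_iff₀ hN0] at h1
  have h2 := le_card_boundedFractions hℓ.le x hN
  have h3 := mul_le_mul_of_nonneg_right h1 hN0.le
  nlinarith

/-! ### The lower bound for the dimension of well approximable numbers -/

theorem inv_sq_le_sub_of_den_le {r r' : ℚ} {N : ℕ} (h : r < r') (hr : r.den ≤ N)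
    (hr' : r'.den ≤ N) : 1 / (N : ℝ) ^ 2 ≤ r' - r := by
  have hd : (0 : ℚ) < r.den := by exact_mod_cast r.den_pos
  have hd' : (0 : ℚ) < r'.den := by exact_mod_cast r'.den_pos
  have hN : (0 : ℚ) < N := hd.trans_le (by exact_mod_cast hr)
  have h1 : (1 : ℚ) ≤ (r' - r) * (r'.den * r.den) := by
    have h2 : (r' - r) * (r'.den * r.den) = ((r'.num * r.den - r.num * r'.den : ℤ) : ℚ) := by
      push_cast
      rw [← Rat.mul_den_eq_num r, ← Rat.mul_den_eq_num r']
      ring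
    have h3 : 0 < (r' - r) * (r'.den * r.den) := mul_pos (sub_pos.2 h) (mul_pos hd' hd)
    rw [h2] at h3 ⊢
    exact_mod_cast h3
  have h4 : (r'.den * r.den : ℚ) ≤ (N : ℚ) ^ 2 := by
    rw [sq]; exact_mod_cast Nat.mul_le_mul hr' hr
  have h5 : 1 / (N : ℚ) ^ 2 ≤ r' - r := by
    rw [div_le_iff₀ (by positivity)]
    exact h1.trans (mul_le_mul_of_nonneg_left h4 (sub_pos.2 h).le)
  have h6 : ((1 / (N : ℚ) ^ 2 : ℚ) : ℝ) ≤ ((r' - r : ℚ) : ℝ) := Rat.cast_le.2 h5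
  push_cast at h6
  exact h6

/-- Any `m` of the rationals of denominator at most `N` in an interval, listed increasingly,
are `N⁻²`-separated. -/
theorem exists_separated_fractions {x ℓ : ℝ} {N m : ℕ}
    (hm : m ≤ (boundedFractions x ℓ N).card) :
    ∃ e : ℕ → ℚ, (∀ i < m, (e i).den ≤ N ∧ x ≤ e i ∧ (e i : ℝ) ≤ x + ℓ) ∧
      ∀ i j, i < j → j < m → ((j : ℝ) - i) / (N : ℝ) ^ 2 ≤ e j - e i := by
  set S := boundedFractions x ℓ N
  let f := S.orderEmbOfFin rfl
  have hmem : ∀ i : Fin S.card, f i ∈ S := fun i => S.orderEmbOfFin_mem rfl i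
  refine ⟨fun i => if h : i < S.card then f ⟨i, h⟩ else 0, fun i hi => ?_, fun i j hij hj => ?_⟩
  · simp only [dif_pos (hi.trans_le hm)]
    exact mem_boundedFractions.1 (hmem _)
  · induction j, hij using Nat.le_induction with
    | base =>
      have h1 : i < S.card := by omega
      have h2 : i + 1 < S.card := by omega
      simp only [dif_pos h1, Nat.succ_eq_add_one, dif_pos h2]
      have h3 := inv_sq_le_sub_of_den_le (f.strictMono
        (show (⟨i, h1⟩ : Fin S.card) < ⟨i + 1, h2⟩ from
        Fin.mk_lt_mk.2 (Nat.lt_succ_self i))) (mem_boundedFractions.1 (hmem _)).1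
        (mem_boundedFractions.1 (hmem _)).1
      refine le_trans (le_of_eq ?_) h3
      push_cast; ring
    | succ j hij ih =>
      have ih := ih (by omega)
      have h1 : j < S.card := by omega
      have h2 : j + 1 < S.card := by omega
      simp only [dif_pos h1, dif_pos h2] at ih ⊢
      have h3 := inv_sq_le_sub_of_den_le (f.strictMono
        (show (⟨j, h1⟩ : Fin S.card) < ⟨j + 1, h2⟩ from
        Fin.mk_lt_mk.2 (Nat.lt_succ_self j))) (mem_boundedFractions.1 (hmem _)).1
        (mem_boundedFractions.1 (hmem _)).1
      have h4 : (((j + 1 : ℕ) : ℝ) - i) / (N : ℝ) ^ 2 =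
          ((j : ℝ) - i) / (N : ℝ) ^ 2 + 1 / (N : ℝ) ^ 2 := by
        push_cast; ring
      rw [h4]
      linarith

/-- One level of a Cantor set of well approximable numbers. The level consists of `M` intervals
of length `L`, and each interval of the preceding level contains `m` of them. The left end point
of the `i`-th interval inside an interval with left end point `x` is the rational `e x i`, of
denominator at most `N`. For the initial level, a single interval, only `L` and `M` matter. -/
structure Level where
  L : ℝ
  M : ℕ
  m : ℕ
  N : ℕ
  e : ℝ → ℕ → ℚ

/-- The condition on a level under which distances between points that are separated at the next
level satisfy a Hölder estimate of exponent `s`. The next level has `m ≥ L N² / 32`, and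
`4 N² / m ≤ 128 / L` compares the `N⁻²`-separation with an equal spacing of `m` points. -/
structure Level.Good (s : ℝ) (D : Level) : Prop where
  L_pos : 0 < D.L
  M_pos : 0 < D.M
  rpow_le : (128 / D.L) ^ s ≤ D.M

/-- `D'` is a possible level following the level `D`: the `m` points in an interval of level `D`
are chosen in its left half, and the intervals attached to them fit in and stay separated. -/
structure Level.Next (τ : ℝ) (D D' : Level) : Prop where
  M_eq : D'.M = D.M * D'.m
  two_le : 2 ≤ D'.m
  N_pos : 0 < D'.N
  L_eq : D'.L = (D'.N : ℝ) ^ (-τ)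
  L_le : D'.L ≤ D.L / 2
  L_le_sep : D'.L ≤ 1 / (2 * (D'.N : ℝ) ^ 2)
  le_m : D.L / 32 * (D'.N : ℝ) ^ 2 ≤ D'.m
  mem : ∀ x, ∀ i < D'.m, (D'.e x i).den ≤ D'.N ∧ x ≤ D'.e x i ∧ (D'.e x i : ℝ) ≤ x + D.L / 2
  sep : ∀ x i j, i < j → j < D'.m →
    ((j : ℝ) - i) / (D'.N : ℝ) ^ 2 ≤ D'.e x j - D'.e x i

/-- Every good level has a good successor: it suffices to take denominators large enough in
terms of the given level. -/
theorem Level.Good.exists_next {τ s : ℝ} (hτ : 2 < τ) (hτs : τ * s < 2) {D : Level}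
    (hD : D.Good s) : ∃ D' : Level, D'.Good s ∧ D.Next τ D' := by
  have hL := hD.L_pos
  have hcast := tendsto_natCast_atTop_atTop (R := ℝ)
  have ev1 := eventually_le_card_boundedFractions (half_pos hL)
  have ev2 : ∀ᶠ N : ℕ in atTop, (N : ℝ) ^ (-τ) ≤ D.L / 2 :=
    ((tendsto_rpow_neg_atTop (by linarith : 0 < τ)).comp hcast).eventually_le_const (half_pos hL)
  have ev3 : ∀ᶠ N : ℕ in atTop, (N : ℝ) ^ (-(τ - 2)) ≤ 1 / 2 :=
    ((tendsto_rpow_neg_atTop (by linarith : 0 < τ - 2)).comp hcast).eventually_le_const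
      (by norm_num)
  have ev4 : ∀ᶠ N : ℕ in atTop, 32 * 128 ^ s / D.L ≤ (N : ℝ) ^ (2 - τ * s) :=
    ((tendsto_rpow_atTop (by linarith : 0 < 2 - τ * s)).comp hcast).eventually_ge_atTop _
  have ev5 : ∀ᶠ N : ℕ in atTop, 64 / D.L ≤ (N : ℝ) := hcast.eventually_ge_atTop _
  obtain ⟨N, h1, h2, h3, h4, h5, h6⟩ :=
    (ev1.and (ev2.and (ev3.and (ev4.and (ev5.and (eventually_ge_atTop 1)))))).exists
  have hN1 : (1 : ℝ) ≤ N := by exact_mod_cast h6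
  have hN0 : (0 : ℝ) < N := by linarith
  set m := ⌈D.L / 32 * (N : ℝ) ^ 2⌉₊ with hm
  have hmle : D.L / 32 * (N : ℝ) ^ 2 ≤ m := Nat.le_ceil _
  have hcard : ∀ x, m ≤ (boundedFractions x (D.L / 2) N).card := fun x =>
    Nat.ceil_le.2 (le_trans (le_of_eq (by ring)) (h1 x))
  choose e he hsep using fun x => exists_separated_fractions (hcard x)
  have hsplit : (N : ℝ) ^ (-τ) * (N : ℝ) ^ 2 = (N : ℝ) ^ (-(τ - 2)) := by
    rw [← Real.rpow_natCast, ← Real.rpow_add hN0]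
    congr 1; push_cast; ring
  refine ⟨⟨(N : ℝ) ^ (-τ), D.M * m, m, N, e⟩, ⟨by positivity, ?_, ?_⟩,
    ⟨rfl, ?_, h6, rfl, h2, ?_, hmle, he, hsep⟩⟩
  · refine Nat.mul_pos hD.M_pos (Nat.ceil_pos.2 (by positivity))
  · have h7 : (128 / (N : ℝ) ^ (-τ)) ^ s = 128 ^ s * (N : ℝ) ^ (τ * s) := by
      rw [Real.rpow_neg hN0.le, div_inv_eq_mul, Real.mul_rpow (by norm_num) (by positivity),
        ← Real.rpow_mul hN0.le]
    have h8 : (N : ℝ) ^ (2 - τ * s) * (N : ℝ) ^ (τ * s) = (N : ℝ) ^ 2 := by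
      rw [← Real.rpow_natCast, ← Real.rpow_add hN0]
      congr 1; push_cast; ring
    have h9 : 128 ^ s * (N : ℝ) ^ (τ * s) ≤ D.L / 32 * (N : ℝ) ^ 2 := by
      rw [← h8, ← mul_assoc]
      refine mul_le_mul_of_nonneg_right ?_ (by positivity)
      rw [div_le_iff₀ hL] at h4
      linarith
    have h10 : (1 : ℝ) ≤ D.M := by exact_mod_cast hD.M_pos
    simp only
    rw [h7]
    push_cast
    have h11 : (m : ℝ) ≤ D.M * m := le_mul_of_one_le_left (by positivity) h10
    linarith
  · have h7 : (2 : ℝ) ≤ m := by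
      refine le_trans ?_ hmle
      rw [div_le_iff₀ hL] at h5
      nlinarith
    exact_mod_cast h7
  · simp only
    rw [le_div_iff₀ (by positivity)]
    rw [← hsplit] at h3
    linarith

/-- An infinite chain of levels, starting from a single interval. -/
theorem exists_level_seq {τ s : ℝ} (hτ : 2 < τ) (hτs : τ * s < 2) :
    ∃ D : ℕ → Level, (D 0).M = 1 ∧ (∀ k, (D k).Good s) ∧ ∀ k, (D k).Next τ (D (k + 1)) := by
  -- with the initial length `128` the condition on the first level is `1 ^ s ≤ 1`
  have h0 : (⟨128, 1, 0, 0, fun _ _ => 0⟩ : Level).Good s := ⟨by norm_num, one_pos, by norm_num⟩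
  choose f hf using fun D : {D : Level // D.Good s} => D.2.exists_next hτ hτs
  let D : ℕ → {D : Level // D.Good s} := fun k =>
    Nat.rec ⟨_, h0⟩ (fun _ E => ⟨f E, (hf E).1⟩) k
  exact ⟨fun k => (D k).1, rfl, fun k => (D k).2, fun k => (hf (D k)).2⟩

/-- The left end point of the `t`-th interval of the `k`-th level. -/
noncomputable def leftEnd (D : ℕ → Level) : ℕ → ℕ → ℝ
  | 0, _ => 0
  | k + 1, t => (D (k + 1)).e (leftEnd D k (t / (D (k + 1)).m)) (t % (D (k + 1)).m)

/-- The left end point of the interval of the `k`-th level that is coded by `u ∈ [0, 1)`: the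
unit interval is divided into equal parts, which correspond to the intervals of the level. -/
noncomputable def codedEnd (D : ℕ → Level) (k : ℕ) (u : ℝ) : ℝ :=
  leftEnd D k ⌊u * (D k).M⌋₊

/-- The parametrization of the Cantor set by `[0, 1)`. -/
noncomputable def cantorPoint (D : ℕ → Level) (u : ℝ) : ℝ := ⨆ k, codedEnd D k u

section Cantor

variable {τ s : ℝ} {D : ℕ → Level}

theorem floor_mul_M_div (hnext : ∀ k, (D k).Next τ (D (k + 1))) (k : ℕ) (u : ℝ) :
    ⌊u * (D (k + 1)).M⌋₊ / (D (k + 1)).m = ⌊u * (D k).M⌋₊ := by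
  have hm : ((D (k + 1)).m : ℝ) ≠ 0 := by
    have := (hnext k).two_le
    exact_mod_cast (by omega : (D (k + 1)).m ≠ 0)
  rw [← Nat.floor_div_natCast, (hnext k).M_eq]
  congr 1
  push_cast
  field_simp

theorem codedEnd_succ (hnext : ∀ k, (D k).Next τ (D (k + 1))) (k : ℕ) (u : ℝ) :
    codedEnd D (k + 1) u =
      (D (k + 1)).e (codedEnd D k u) (⌊u * (D (k + 1)).M⌋₊ % (D (k + 1)).m) := by
  rw [codedEnd, leftEnd, floor_mul_M_div hnext, codedEnd]

theorem codedEnd_succ_mem (hnext : ∀ k, (D k).Next τ (D (k + 1))) (k : ℕ) (u : ℝ) :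
    codedEnd D k u ≤ codedEnd D (k + 1) u ∧
      codedEnd D (k + 1) u ≤ codedEnd D k u + (D k).L / 2 := by
  rw [codedEnd_succ hnext]
  exact ((hnext k).mem _ _ (Nat.mod_lt _ (by have := (hnext k).two_le; omega))).2

theorem cantorPoint_mem_Icc (hgood : ∀ k, (D k).Good s) (hnext : ∀ k, (D k).Next τ (D (k + 1)))
    (k : ℕ) (u : ℝ) :
    cantorPoint D u ∈ Set.Icc (codedEnd D k u) (codedEnd D k u + (D k).L) := by
  have hmono : Monotone fun k => codedEnd D k u :=
    monotone_nat_of_le_succ fun k => (codedEnd_succ_mem hnext k u).1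
  have hanti : Antitone fun k => codedEnd D k u + (D k).L :=
    antitone_nat_of_succ_le fun k => by
      have h1 := (codedEnd_succ_mem hnext k u).2
      have h2 := (hnext k).L_le
      linarith
  have hle : ∀ n, codedEnd D n u ≤ codedEnd D k u + (D k).L := fun n => by
    have h1 := hmono (le_max_left n k)
    have h2 := hanti (le_max_right n k)
    have h3 := (hgood (max n k)).L_pos
    simp only at h1 h2
    linarith
  exact ⟨le_ciSup (f := fun k => codedEnd D k u) ⟨_, Set.forall_mem_range.2 hle⟩ k, ciSup_le hle⟩

theorem two_pow_le_M (hgood : ∀ k, (D k).Good s) (hnext : ∀ k, (D k).Next τ (D (k + 1))) (k : ℕ) :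
    2 ^ k ≤ (D k).M := by
  induction k with
  | zero => exact (hgood 0).M_pos
  | succ k ih =>
    rw [(hnext k).M_eq, pow_succ]
    exact Nat.mul_le_mul ih (hnext k).two_le

theorem cantorPoint_mem_approxSet (hτ : 2 < τ) (hgood : ∀ k, (D k).Good s)
    (hnext : ∀ k, (D k).Next τ (D (k + 1))) (u : ℝ) : cantorPoint D u ∈ approxSet 1 τ := by
  intro δ hδ
  have hL : Tendsto (fun k => (D k).L) atTop (𝓝 0) := by
    have h1 : ∀ k, (D k).L ≤ (D 0).L * (1 / 2) ^ k := by
      intro k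
      induction k with
      | zero => simp
      | succ k ih => rw [pow_succ]; have := (hnext k).L_le; linarith
    have h2 := (tendsto_pow_atTop_nhds_zero_of_lt_one (r := (1 / 2 : ℝ)) (by norm_num)
      (by norm_num)).const_mul (D 0).L
    rw [mul_zero] at h2
    exact squeeze_zero (fun k => (hgood k).L_pos.le) h1 h2
  obtain ⟨k, hk⟩ :=
    ((hL.comp (tendsto_add_atTop_nat 1)).eventually_le_const hδ).exists
  have hmem := cantorPoint_mem_Icc hgood hnext (k + 1) u
  rw [codedEnd_succ hnext] at hmem
  have hden := ((hnext k).mem (codedEnd D k u) (⌊u * (D (k + 1)).M⌋₊ % (D (k + 1)).m)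
    (Nat.mod_lt _ (by have := (hnext k).two_le; omega))).1
  set r := (D (k + 1)).e (codedEnd D k u) (⌊u * (D (k + 1)).M⌋₊ % (D (k + 1)).m)
  have habs : |cantorPoint D u - r| ≤ (D (k + 1)).L := by
    rw [abs_of_nonneg (sub_nonneg.2 hmem.1)]
    linarith [hmem.2]
  refine ⟨r, habs.trans hk, habs.trans ?_⟩
  rw [(hnext k).L_eq, one_mul]
  exact Real.rpow_le_rpow_of_nonpos (by exact_mod_cast r.den_pos) (by exact_mod_cast hden)
    (by linarith)

/-- The parametrization of the Cantor set expands distances at least like the power `1 / s`.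
Two parameters are compared at the first level where their codes differ. -/
theorem sub_le_rpow_cantorPoint (hs : 0 < s) (hs1 : s < 1) (h0 : (D 0).M = 1)
    (hgood : ∀ k, (D k).Good s) (hnext : ∀ k, (D k).Next τ (D (k + 1))) {u v : ℝ}
    (hu : 0 ≤ u) (huv : u < v) (hv : v < 1) :
    v - u ≤ |cantorPoint D v - cantorPoint D u| ^ s := by
  classical
  have hex : ∃ k, ⌊u * (D k).M⌋₊ ≠ ⌊v * (D k).M⌋₊ := by
    obtain ⟨k, hk⟩ := pow_unbounded_of_one_lt (1 / (v - u)) (one_lt_two (α := ℝ))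
    refine ⟨k, fun heq => ?_⟩
    have h1 : (2 : ℝ) ^ k ≤ (D k).M := by exact_mod_cast two_pow_le_M hgood hnext k
    rw [div_lt_iff₀ (sub_pos.2 huv)] at hk
    have h2 := Nat.floor_le (a := u * (D k).M) (by positivity)
    have h3 := Nat.lt_floor_add_one (v * (D k).M)
    rw [← heq] at h3
    nlinarith
  obtain ⟨k, hk⟩ : ∃ k, Nat.find hex = k + 1 := by
    refine Nat.exists_eq_succ_of_ne_zero fun h => ?_
    have h1 := Nat.find_spec hex
    rw [h, h0] at h1
    refine h1 ?_
    rw [Nat.floor_eq_zero.2 (by push_cast; linarith), Nat.floor_eq_zero.2 (by push_cast; linarith)]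
  have hne : ⌊u * (D (k + 1)).M⌋₊ ≠ ⌊v * (D (k + 1)).M⌋₊ := hk ▸ Nat.find_spec hex
  have heq : ⌊u * (D k).M⌋₊ = ⌊v * (D k).M⌋₊ := by
    by_contra h
    have := Nat.find_min' hex h
    omega
  have hM : (0 : ℝ) < (D k).M := by exact_mod_cast (hgood k).M_pos
  have hm : (0 : ℝ) < (D (k + 1)).m := by
    have := (hnext k).two_le
    exact_mod_cast (by omega : 0 < (D (k + 1)).m)
  have hN : (0 : ℝ) < (D (k + 1)).N := by exact_mod_cast (hnext k).N_pos
  have hcu := codedEnd_succ hnext k u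
  have hcv := codedEnd_succ hnext k v
  have hcuv : codedEnd D k u = codedEnd D k v := by rw [codedEnd, codedEnd, heq]
  have hmodu := Nat.div_add_mod ⌊u * (D (k + 1)).M⌋₊ (D (k + 1)).m
  have hmodv := Nat.div_add_mod ⌊v * (D (k + 1)).M⌋₊ (D (k + 1)).m
  rw [floor_mul_M_div hnext] at hmodu hmodv
  have hjm : ⌊v * (D (k + 1)).M⌋₊ % (D (k + 1)).m < (D (k + 1)).m :=
    Nat.mod_lt _ (by have := (hnext k).two_le; omega)
  set i := ⌊u * (D (k + 1)).M⌋₊ % (D (k + 1)).m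
  set j := ⌊v * (D (k + 1)).M⌋₊ % (D (k + 1)).m
  have hfloor : ⌊u * (D (k + 1)).M⌋₊ ≤ ⌊v * (D (k + 1)).M⌋₊ :=
    Nat.floor_mono (mul_le_mul_of_nonneg_right huv.le (by positivity))
  rw [← heq] at hmodv
  have hij : i < j := by omega
  have hij' : (1 : ℝ) ≤ (j : ℝ) - i := by
    have : (i : ℝ) + 1 ≤ j := by exact_mod_cast hij
    linarith
  have hd : 0 < v - u := sub_pos.2 huv
  have hd1 : v - u ≤ 1 / (D k).M := by
    rw [le_div_iff₀ hM]
    have h2 := Nat.floor_le (a := u * (D k).M) (by positivity)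
    have h3 := Nat.lt_floor_add_one (v * (D k).M)
    rw [← heq] at h3
    linarith
  have hd2 : v - u ≤ 1 / (D k).M * (2 * ((j : ℝ) - i) / (D (k + 1)).m) := by
    rw [div_mul_div_comm, le_div_iff₀ (by positivity)]
    have h2 := Nat.floor_le (a := u * (D (k + 1)).M) (by positivity)
    have h3 := Nat.lt_floor_add_one (v * (D (k + 1)).M)
    rw [← hmodu] at h2
    rw [← hmodv] at h3
    rw [(hnext k).M_eq] at h2 h3
    push_cast at h2 h3
    linarith
  have hgap : 2 * ((j : ℝ) - i) / (D (k + 1)).m * ((D (k + 1)).m / (4 * (D (k + 1)).N ^ 2)) ≤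
      |cantorPoint D v - cantorPoint D u| := by
    refine le_trans ?_ (le_abs_self _)
    have h2 := (cantorPoint_mem_Icc hgood hnext (k + 1) u).2
    have h3 := (cantorPoint_mem_Icc hgood hnext (k + 1) v).1
    have h4 := (hnext k).sep (codedEnd D k u) i j hij hjm
    have h5 := (hnext k).L_le_sep
    rw [hcu] at h2
    rw [hcv, ← hcuv] at h3
    have h6 : 1 / (2 * ((D (k + 1)).N : ℝ) ^ 2) ≤
        ((j : ℝ) - i) / (2 * ((D (k + 1)).N : ℝ) ^ 2) := by
      gcongr
    have h7 : 2 * ((j : ℝ) - i) / (D (k + 1)).m * ((D (k + 1)).m / (4 * (D (k + 1)).N ^ 2)) =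
        ((j : ℝ) - i) / (D (k + 1)).N ^ 2 - ((j : ℝ) - i) / (2 * ((D (k + 1)).N : ℝ) ^ 2) := by
      field_simp; ring
    rw [h7]
    linarith
  have hmN : 1 / ((D k).M : ℝ) ≤ ((D (k + 1)).m / (4 * ((D (k + 1)).N : ℝ) ^ 2)) ^ s := by
    have hL := (hgood k).L_pos
    have h2 : (D k).L / 128 ≤ (D (k + 1)).m / (4 * ((D (k + 1)).N : ℝ) ^ 2) := by
      rw [div_le_div_iff₀ (by norm_num) (by positivity)]
      have := (hnext k).le_m
      linarith
    refine le_trans ?_ (Real.rpow_le_rpow (by positivity) h2 hs.le)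
    have h3 : ((D k).L / 128) ^ s = ((128 / (D k).L) ^ s)⁻¹ := by
      rw [← Real.inv_rpow (by positivity), inv_div]
    rw [h3, one_div]
    exact inv_anti₀ (by positivity) (hgood k).rpow_le
  set w := 2 * ((j : ℝ) - i) / (D (k + 1)).m with hw
  have hw0 : 0 ≤ w := by rw [hw]; exact div_nonneg (by linarith) hm.le
  -- interpolate between the two bounds for `v - u`
  calc v - u = (v - u) ^ (1 - s) * (v - u) ^ s := by
        rw [← Real.rpow_add hd, sub_add_cancel, Real.rpow_one]
    _ ≤ (1 / (D k).M) ^ (1 - s) * (1 / (D k).M * w) ^ s := by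
        gcongr
    _ = w ^ s * (1 / (D k).M) := by
        rw [Real.mul_rpow (by positivity) hw0, ← mul_assoc, ← Real.rpow_add (by positivity),
          sub_add_cancel, Real.rpow_one, mul_comm]
    _ ≤ w ^ s * ((D (k + 1)).m / (4 * ((D (k + 1)).N : ℝ) ^ 2)) ^ s := by gcongr
    _ = (w * ((D (k + 1)).m / (4 * ((D (k + 1)).N : ℝ) ^ 2))) ^ s := by
        rw [Real.mul_rpow hw0 (by positivity)]
    _ ≤ _ := by gcongr

end Cantor

/-- A map that expands distances at least like the power `1 / s` decreases the Hausdorff dimension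
at most by the factor `s`, since its inverse is Hölder continuous. -/
theorem dimH_le_dimH_image_div_of_abs_sub_le {s : NNReal} (hs : 0 < s) {A : Set ℝ} {h : ℝ → ℝ}
    (hA : ∀ u ∈ A, ∀ v ∈ A, |u - v| ≤ |h u - h v| ^ (s : ℝ)) :
    dimH A ≤ dimH (h '' A) / s := by
  have hinj : Set.InjOn h A := by
    intro u hu v hv huv
    have h1 := hA u hu v hv
    rw [huv, sub_self, abs_zero, Real.zero_rpow (by exact_mod_cast hs.ne')] at h1
    exact sub_eq_zero.1 (abs_nonpos_iff.1 h1)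
  have himage : Function.invFunOn h A '' (h '' A) = A := by
    rw [hinj.invFunOn_image subset_rfl]
  have hhol : HolderOnWith 1 s (Function.invFunOn h A) (h '' A) := by
    rintro _ ⟨u, hu, rfl⟩ _ ⟨v, hv, rfl⟩
    rw [hinj.leftInvOn_invFunOn hu, hinj.leftInvOn_invFunOn hv, ENNReal.coe_one, one_mul,
      edist_dist, edist_dist, Real.dist_eq, Real.dist_eq,
      ENNReal.ofReal_rpow_of_nonneg (abs_nonneg _) s.coe_nonneg]
    exact ENNReal.ofReal_le_ofReal (hA u hu v hv)
  have := hhol.dimH_image_le hs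
  rwa [himage] at this

/-- The lower bound in the theorem of Jarník and Besicovitch. -/
theorem le_dimH_approxSet {τ : ℝ} (hτ : 2 < τ) :
    ENNReal.ofReal (2 / τ) ≤ dimH (approxSet 1 τ) := by
  refine le_of_forall_lt fun a ha => ?_
  lift a to NNReal using ha.ne_top
  rw [← ENNReal.ofReal_coe_nnreal, ENNReal.ofReal_lt_ofReal_iff (by positivity)] at ha
  obtain ⟨s, has, hsτ⟩ := exists_between ha
  have hs : 0 < s := a.2.trans_lt has
  have hτs : τ * s < 2 := by rwa [lt_div_iff₀' (by linarith)] at hsτ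
  have hs1 : s < 1 := by nlinarith
  lift s to NNReal using hs.le
  obtain ⟨D, h0, hgood, hnext⟩ := exists_level_seq hτ hτs
  have h1 : dimH (Set.Ico (0 : ℝ) 1) ≤ dimH (cantorPoint D '' Set.Ico (0 : ℝ) 1) / s := by
    refine dimH_le_dimH_image_div_of_abs_sub_le (by exact_mod_cast hs) fun u hu v hv => ?_
    rcases lt_trichotomy u v with h | rfl | h
    · rw [abs_sub_comm, abs_of_pos (sub_pos.2 h), abs_sub_comm (cantorPoint D u)]
      exact sub_le_rpow_cantorPoint hs hs1 h0 hgood hnext hu.1 h hv.2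
    · rw [sub_self, abs_zero]; positivity
    · rw [abs_of_pos (sub_pos.2 h)]
      exact sub_le_rpow_cantorPoint hs hs1 h0 hgood hnext hv.1 h hu.2
  rw [Real.dimH_of_nonempty_interior (by rw [interior_Ico]; exact ⟨1 / 2, by norm_num⟩),
    Module.finrank_self, Nat.cast_one, ENNReal.le_div_iff_mul_le (by left; exact_mod_cast hs.ne')
      (by left; exact ENNReal.coe_ne_top), one_mul] at h1
  have h2 : cantorPoint D '' Set.Ico (0 : ℝ) 1 ⊆ approxSet 1 τ := by
    rintro _ ⟨u, -, rfl⟩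
    exact cantorPoint_mem_approxSet hτ hgood hnext u
  exact lt_of_lt_of_le (by exact_mod_cast has) (h1.trans (dimH_mono h2))

/-! ### Approximation on the curve and approximation of the parameter -/

theorem aeval_ratCast (p : ℚ[X]) (r : ℚ) : aeval (r : ℝ) p = ((p.eval r : ℚ) : ℝ) := by
  have := aeval_algebraMap_apply_eq_algebraMap_eval (A := ℝ) r p
  simpa using this

theorem exists_abs_aeval_sub_le (p : ℚ[X]) (x : ℝ) :
    ∃ K : ℝ, 0 ≤ K ∧ ∀ y : ℝ, |x - y| ≤ 1 → |aeval x p - aeval y p| ≤ K * |x - y| := by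
  obtain ⟨Q, hQ⟩ := X_sub_C_dvd_sub_C_eval (a := x) (p := p.map (algebraMap ℚ ℝ))
  obtain ⟨K, hK⟩ := (isCompact_Icc (a := x - 1) (b := x + 1)).exists_bound_of_continuousOn
    Q.continuous.continuousOn
  refine ⟨max K 0, le_max_right _ _, fun y hy => ?_⟩
  have h1 := congrArg (eval y) hQ
  simp only [eval_sub, eval_mul, eval_X, eval_C, eval_map_algebraMap] at h1
  rw [abs_sub_comm, h1, abs_mul, abs_sub_comm y x, mul_comm]
  refine mul_le_mul_of_nonneg_right (le_trans ?_ (le_max_left _ _)) (abs_nonneg _)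
  rw [abs_le] at hy
  exact hK y ⟨by linarith, by linarith⟩

theorem exists_abs_aeval_sub_le_of_fintype {ι : Type*} [Fintype ι] (P : ι → ℚ[X]) (x : ℝ) :
    ∃ K : ℝ, 0 ≤ K ∧ ∀ j, ∀ y : ℝ, |x - y| ≤ 1 →
      |aeval x (P j) - aeval y (P j)| ≤ K * |x - y| := by
  choose K hK0 hK using fun j => exists_abs_aeval_sub_le (P j) x
  refine ⟨∑ j, K j, Finset.sum_nonneg fun j _ => hK0 j, fun j y hy => (hK j y hy).trans ?_⟩
  exact mul_le_mul_of_nonneg_right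
    (Finset.single_le_sum (fun j _ => hK0 j) (Finset.mem_univ j)) (abs_nonneg _)

theorem exists_common_denominator_multiple {ι : Type*} [Fintype ι] (P : ι → ℚ[X]) :
    ∃ D : ℕ, 0 < D ∧ ∀ j, ∀ r : ℚ, ∃ z : ℤ,
      (D : ℚ) * (r.den : ℚ) ^ (P j).natDegree * (P j).eval r = z := by
  classical
  choose D hD0 hD using fun j => exists_denominator_multiple (P j)
  refine ⟨∏ j, D j, Finset.prod_pos fun j _ => hD0 j, fun j r => ?_⟩
  obtain ⟨z, hz⟩ := hD j r
  obtain ⟨c, hc⟩ := Finset.dvd_prod_of_mem D (Finset.mem_univ j)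
  refine ⟨c * z, ?_⟩
  rw [hc]
  push_cast
  rw [← hz]
  ring

theorem exists_common_den_pow_dvd {ι : Type*} [Fintype ι] (P : ι → ℚ[X])
    (hP : ∀ j, 1 ≤ (P j).natDegree) :
    ∃ B : ℕ, 0 < B ∧ ∀ j, ∀ (r : ℚ) (q : ℕ), (∃ z : ℤ, (q : ℚ) * (P j).eval r = z) →
      r.den ^ (P j).natDegree ∣ B * q := by
  classical
  choose B hB0 hB using fun j => exists_den_pow_dvd (P j) (hP j)
  refine ⟨∏ j, B j, Finset.prod_pos fun j _ => hB0 j, fun j r q h => ?_⟩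
  exact (hB j r q h).trans (mul_dvd_mul_right (Finset.dvd_prod_of_mem B (Finset.mem_univ j)) q)

/-- The point of the curve with parameter `x`. -/
noncomputable def curvePoint {k : ℕ} (P : Fin k → ℚ[X]) (x : ℝ) : EuclideanSpace ℝ (Fin k) :=
  WithLp.toLp 2 fun j : Fin k => aeval x (P j)

/-- Good rational approximations of the parameter yield good simultaneous approximations of the
point of the curve: if `r` is close to `x` then `q = D * r.den ^ d` clears the denominators
of all `P j (r)`. -/
theorem curvePoint_mem_simApprox {k d : ℕ} (P : Fin k → ℚ[X]) (hd : ∀ j, (P j).natDegree ≤ d)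
    (hd0 : 1 ≤ d) {lam x : ℝ} (hlam : 0 < lam) (hirr : Irrational x)
    (hx : x ∈ approxSet 1 (d * (lam + 1))) : curvePoint P x ∈ simApprox k lam := by
  intro ε hε
  obtain ⟨D, hD0, hD⟩ := exists_common_denominator_multiple P
  obtain ⟨K, hK0, hK⟩ := exists_abs_aeval_sub_le_of_fintype P x
  have hDR : (0 : ℝ) < D := by exact_mod_cast hD0
  have hlarge : ∀ᶠ q : ℕ in atTop, K * (D : ℝ) ^ (lam + 1) ≤ (q : ℝ) ^ ε :=
    ((tendsto_rpow_atTop hε).comp tendsto_natCast_atTop_atTop).eventually_ge_atTop _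
  obtain ⟨q₀, hq₀⟩ := eventually_atTop.1 hlarge
  refine Set.infinite_of_not_bddAbove fun ⟨M, hM⟩ => ?_
  -- a rational close enough to `x` has denominator larger than any given bound
  have hfar : ∀ᶠ δ : ℝ in 𝓝[>] 0, ∀ r : ℚ, r.den ≤ max M q₀ → δ ≤ dist x r :=
    nhdsWithin_le_nhds (hirr.eventually_forall_le_dist_cast_rat_of_den_le (max M q₀))
  obtain ⟨δ, hδ, hδ0 : 0 < δ⟩ := (hfar.and self_mem_nhdsWithin).exists
  obtain ⟨r, hr1, hr2⟩ := hx (min (δ / 2) 1) (by positivity)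
  have hden : max M q₀ < r.den := by
    by_contra hle
    have := hδ r (not_lt.1 hle)
    rw [Real.dist_eq] at this
    linarith [hr1.trans (min_le_left _ _)]
  have hb : (0 : ℝ) < r.den := by exact_mod_cast r.den_pos
  set q : ℕ := D * r.den ^ d with hq
  have hqden : r.den ≤ q := by
    calc r.den = r.den ^ 1 := (pow_one _).symm
      _ ≤ r.den ^ d := Nat.pow_le_pow_right r.den_pos hd0
      _ ≤ q := Nat.le_mul_of_pos_left _ hD0
  have hqpos : 0 < q := r.den_pos.trans_le hqden
  have hqR : (0 : ℝ) < q := by exact_mod_cast hqpos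
  have hqM : M < q := (le_max_left _ _).trans_lt (hden.trans_le hqden)
  refine absurd (hM (show q ∈ _ from ⟨hqpos, fun j => ?_⟩)) (not_le.2 hqM)
  obtain ⟨z, hz⟩ : ∃ z : ℤ, (q : ℚ) * (P j).eval r = z := by
    obtain ⟨z, hz⟩ := hD j r
    refine ⟨r.den ^ (d - (P j).natDegree) * z, ?_⟩
    push_cast
    rw [← hz, hq, ← Nat.sub_add_cancel (hd j), pow_add]
    push_cast
    simp only [Nat.sub_add_cancel (hd j)]
    ring
  have hzR : (z : ℝ) = q * aeval (r : ℝ) (P j) := by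
    rw [aeval_ratCast]; exact_mod_cast hz.symm
  have hqD : (q : ℝ) / D = (r.den : ℝ) ^ (d : ℝ) := by
    rw [hq, Real.rpow_natCast]; push_cast; field_simp
  have hrx : |x - r| ≤ ((q : ℝ) / D) ^ (-(lam + 1)) := by
    rw [hqD, ← Real.rpow_mul hb.le]
    refine hr2.trans (le_of_eq ?_)
    rw [one_mul, mul_neg]
  calc distNearestInt ((q : ℝ) * aeval x (P j)) ≤ |(q : ℝ) * aeval x (P j) - z| := round_le _ _
    _ = q * |aeval x (P j) - aeval (r : ℝ) (P j)| := by
        rw [hzR, ← mul_sub, abs_mul, abs_of_pos hqR]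
    _ ≤ q * (K * ((q : ℝ) / D) ^ (-(lam + 1))) := by
        refine mul_le_mul_of_nonneg_left ((hK j r (hr1.trans (min_le_right _ _))).trans ?_) hqR.le
        exact mul_le_mul_of_nonneg_left hrx hK0
    _ = K * (D : ℝ) ^ (lam + 1) * (q : ℝ) ^ (-lam) := by
        have h1 : (q : ℝ) ^ (-lam) = q * (q : ℝ) ^ (-(lam + 1)) := by
          rw [← Real.rpow_one_add' hqR.le (by linarith)]
          congr 1; ring
        rw [h1, Real.div_rpow hqR.le hDR.le, Real.rpow_neg hDR.le, div_inv_eq_mul]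
        ring
    _ ≤ (q : ℝ) ^ ε * (q : ℝ) ^ (-lam) := by
        refine mul_le_mul_of_nonneg_right (hq₀ q ?_) (by positivity)
        exact (le_max_right _ _).trans (hden.le.trans hqden)
    _ = (q : ℝ) ^ (-lam + ε) := by rw [← Real.rpow_add hqR, add_comm]

/-- The heart of the matter: if `q * P j (r)` is integral, then `r.den ^ deg (P j)` essentially
divides `q`, hence the denominator of `q * P (j + 1) (r)` is at most about `r.den ^ t`. So if this
number is also very close to an integer, then it is an integer. -/
theorem exists_int_eq_mul_eval {n : ℕ} {P : Fin (n + 1) → ℚ[X]} {t B D q : ℕ} {r : ℚ} {η : ℝ}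
    (hP : P 0 = X) (ht : ∀ j : Fin n, (P j.succ).natDegree ≤ (P j.castSucc).natDegree + t)
    (hB0 : 0 < B) (hD0 : 0 < D) (hq0 : 0 < q)
    (hB : ∀ j, (∃ z : ℤ, (q : ℚ) * (P j).eval r = z) → r.den ^ (P j).natDegree ∣ B * q)
    (hD : ∀ j, ∃ z : ℤ, (D : ℚ) * (r.den : ℚ) ^ (P j).natDegree * (P j).eval r = z)
    (hr : r.den ∣ q) (hη : η * (B * D * (q : ℝ) ^ t) < 1)
    (happrox : ∀ j, ∃ z : ℤ, |(q : ℝ) * ((P j).eval r : ℚ) - z| ≤ η) (j : Fin (n + 1)) :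
    ∃ z : ℤ, (q : ℚ) * (P j).eval r = z := by
  induction j using Fin.induction with
  | zero =>
    obtain ⟨c, hc⟩ := hr
    refine ⟨c * r.num, ?_⟩
    rw [hP, eval_X, hc, Int.cast_mul, ← Rat.mul_den_eq_num r]
    push_cast
    ring
  | succ j ih =>
    obtain ⟨z, hz⟩ := happrox j.succ
    obtain ⟨y, hy⟩ := hD j.succ
    obtain ⟨c, hc⟩ : r.den ^ (P j.succ).natDegree ∣ B * q * r.den ^ t :=
      (pow_dvd_pow _ (ht j)).trans (by rw [pow_add]; exact mul_dvd_mul_right (hB _ ih) _)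
    refine ⟨z, ?_⟩
    -- `w` is an integer of absolute value less than `1`
    have hw : (B * D * r.den ^ t : ℚ) * (q * (P j.succ).eval r - z) =
        ((c * y - B * D * r.den ^ t * z : ℤ) : ℚ) := by
      have hcQ : (B * q * r.den ^ t : ℚ) = r.den ^ (P j.succ).natDegree * c := by exact_mod_cast hc
      push_cast
      rw [← hy]
      linear_combination (D * (P j.succ).eval r : ℚ) * hcQ
    set w : ℤ := c * y - B * D * r.den ^ t * z
    have hden : (r.den : ℝ) ^ t ≤ (q : ℝ) ^ t := by
      have : (r.den : ℝ) ≤ q := by exact_mod_cast Nat.le_of_dvd hq0 hr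
      gcongr
    have hwR : |(w : ℝ)| < 1 := by
      have h1 : (w : ℝ) = (B * D * r.den ^ t : ℝ) * (q * ((P j.succ).eval r : ℚ) - z) := by
        exact_mod_cast congrArg (fun a : ℚ => (a : ℝ)) hw.symm
      rw [h1, abs_mul, abs_of_nonneg (by positivity)]
      refine lt_of_le_of_lt ?_ hη
      rw [mul_comm]
      gcongr
      exact (abs_nonneg _).trans hz
    have hw0 : w = 0 := Int.abs_lt_one_iff.1 (by exact_mod_cast hwR)
    rw [hw0, Int.cast_zero, mul_eq_zero] at hw
    have hb : (r.den : ℚ) ≠ 0 := by exact_mod_cast r.den_nz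
    rcases hw with h | h
    · exfalso
      have : (B * D * r.den ^ t : ℚ) ≠ 0 := by positivity
      exact this h
    · exact sub_eq_zero.1 h

/-- Good simultaneous approximations of a point of the curve come from good rational
approximations of its parameter. -/
theorem mem_approxSet_of_curvePoint_mem {n t d B : ℕ} {P : Fin (n + 1) → ℚ[X]}
    (hP : P 0 = X) (ht : ∀ j : Fin n, (P j.succ).natDegree ≤ (P j.castSucc).natDegree + t)
    (hd : (P (Fin.last n)).natDegree = d) (hB0 : 0 < B)
    (hB : ∀ j, ∀ (r : ℚ) (q : ℕ), (∃ z : ℤ, (q : ℚ) * (P j).eval r = z) →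
      r.den ^ (P j).natDegree ∣ B * q)
    {lam κ x : ℝ} (hκ : (t : ℝ) < κ) (hlam : κ < lam)
    (hx : curvePoint P x ∈ simApprox (n + 1) lam) :
    x ∈ approxSet ((B : ℝ) ^ (κ + 1)) (d * (κ + 1)) := by
  intro δ hδ
  obtain ⟨D, hD0, hD⟩ := exists_common_denominator_multiple P
  obtain ⟨K, hK0, hK⟩ := exists_abs_aeval_sub_le_of_fintype P x
  have hκ0 : 0 < κ := lt_of_le_of_lt (Nat.cast_nonneg t) hκ
  have ev1 : ∀ᶠ q : ℕ in atTop, (q : ℝ) ^ (-(κ + 1)) ≤ min δ 1 :=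
    ((tendsto_rpow_neg_atTop (by linarith : 0 < κ + 1)).comp
      tendsto_natCast_atTop_atTop).eventually_le_const (by positivity)
  have ev2 : ∀ᶠ q : ℕ in atTop, (1 + K) * (B * D) * (q : ℝ) ^ (-(κ - t)) < 1 := by
    have := ((tendsto_rpow_neg_atTop (sub_pos.2 hκ)).comp
      (tendsto_natCast_atTop_atTop (R := ℝ))).const_mul ((1 + K) * (B * D))
    rw [mul_zero] at this
    exact this.eventually_lt_const one_pos
  obtain ⟨q, ⟨hq0, hqx⟩, h1, h2⟩ :=
    (((Nat.frequently_atTop_iff_infinite).2 (hx (lam - κ) (sub_pos.2 hlam))).and_eventually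
      (ev1.and ev2)).exists
  have hqR : (0 : ℝ) < q := by exact_mod_cast hq0
  have hexp : -lam + (lam - κ) = -κ := by ring
  rw [hexp] at hqx
  set r : ℚ := (round ((q : ℝ) * x) : ℤ) / (q : ℤ) with hr
  have hrden : r.den ∣ q := by
    have h3 := Rat.den_dvd (round ((q : ℝ) * x)) q
    rw [Rat.divInt_eq_div, ← hr] at h3
    exact_mod_cast h3
  have hqsplit : (q : ℝ) * (q : ℝ) ^ (-(κ + 1)) = (q : ℝ) ^ (-κ) := by
    rw [← Real.rpow_one_add' hqR.le (by linarith)]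
    congr 1; ring
  have hxr : |x - r| ≤ (q : ℝ) ^ (-(κ + 1)) := by
    have h3 : |(q : ℝ) * x - round ((q : ℝ) * x)| ≤ (q : ℝ) ^ (-κ) := by
      have := hqx 0
      simpa [curvePoint, hP, distNearestInt] using this
    have h4 : (q : ℝ) * x - round ((q : ℝ) * x) = q * (x - r) := by
      rw [hr]; push_cast; field_simp
    rw [h4, abs_mul, abs_of_pos hqR, ← hqsplit] at h3
    exact le_of_mul_le_mul_left h3 hqR
  refine ⟨r, hxr.trans (h1.trans (min_le_left _ _)), hxr.trans ?_⟩
  have hint : ∃ z : ℤ, (q : ℚ) * (P (Fin.last n)).eval r = z := by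
    refine exists_int_eq_mul_eval (η := (1 + K) * (q : ℝ) ^ (-κ)) hP ht hB0 hD0 hq0
      (fun j => hB j r q) (fun j => hD j r) hrden ?_ (fun j => ?_) _
    · refine lt_of_eq_of_lt ?_ h2
      have : (q : ℝ) ^ (-(κ - t)) = (q : ℝ) ^ (-κ) * (q : ℝ) ^ t := by
        rw [← Real.rpow_natCast, ← Real.rpow_add hqR]
        congr 1; ring
      rw [this]; ring
    · refine ⟨round ((q : ℝ) * aeval x (P j)), ?_⟩
      have h3 : |(q : ℝ) * aeval x (P j) - round ((q : ℝ) * aeval x (P j))| ≤ (q : ℝ) ^ (-κ) :=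
        hqx j
      have h4 : |(q : ℝ) * aeval (r : ℝ) (P j) - q * aeval x (P j)| ≤ K * (q : ℝ) ^ (-κ) := by
        rw [← mul_sub, abs_mul, abs_of_pos hqR, abs_sub_comm, ← hqsplit]
        have h5 := (hK j r (hxr.trans (h1.trans (min_le_right _ _)))).trans
          (mul_le_mul_of_nonneg_left hxr hK0)
        have := mul_le_mul_of_nonneg_left h5 hqR.le
        linarith
      rw [← aeval_ratCast]
      have h6 := abs_sub_le ((q : ℝ) * aeval (r : ℝ) (P j)) (q * aeval x (P j))
        (round ((q : ℝ) * aeval x (P j)))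
      linarith
  have hle : r.den ^ d ≤ B * q := Nat.le_of_dvd (Nat.mul_pos hB0 hq0) (hd ▸ hB _ r q hint)
  have hb : (0 : ℝ) < r.den := by exact_mod_cast r.den_pos
  have hBR : (0 : ℝ) < B := by exact_mod_cast hB0
  have hle' : (r.den : ℝ) ^ (d : ℝ) / B ≤ q := by
    rw [Real.rpow_natCast, div_le_iff₀' hBR]
    exact_mod_cast hle
  refine (Real.rpow_le_rpow_of_nonpos (by positivity) hle' (by linarith)).trans (le_of_eq ?_)
  rw [Real.div_rpow (by positivity) hBR.le, ← Real.rpow_mul hb.le, Real.rpow_neg hBR.le,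
    div_inv_eq_mul, mul_neg, mul_comm]

/-! ### The dimension of the set of well approximable points of the curve -/

theorem contDiff_curvePoint {k : ℕ} (P : Fin k → ℚ[X]) : ContDiff ℝ 1 (curvePoint P) := by
  rw [contDiff_euclidean]
  intro j
  simpa [curvePoint] using Polynomial.contDiff_aeval (P j) 1

theorem dimH_image_curvePoint {n : ℕ} {P : Fin (n + 1) → ℚ[X]} (hP : P 0 = X) (S : Set ℝ) :
    dimH (curvePoint P '' S) = dimH S := by
  refine le_antisymm ((contDiff_curvePoint P).contDiffOn.dimH_image_le convex_univ
    (Set.subset_univ S)) ?_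
  have hproj : ContDiff ℝ 1 fun v : EuclideanSpace ℝ (Fin (n + 1)) => v 0 :=
    (EuclideanSpace.proj (𝕜 := ℝ) (0 : Fin (n + 1))).contDiff
  have h := hproj.contDiffOn.dimH_image_le convex_univ (Set.subset_univ (curvePoint P '' S))
  rw [Set.image_image] at h
  simpa [curvePoint, hP] using h

theorem dimH_preimage_curvePoint_le {n t : ℕ} {P : Fin (n + 1) → ℚ[X]} (hP : P 0 = X)
    (hdeg : ∀ j, 1 ≤ (P j).natDegree)
    (ht : ∀ j : Fin n, (P j.succ).natDegree ≤ (P j.castSucc).natDegree + t)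
    {lam : ℝ} (hlam : (t : ℝ) < lam) :
    dimH (curvePoint P ⁻¹' simApprox (n + 1) lam) ≤
      ENNReal.ofReal (2 / ((P (Fin.last n)).natDegree * (lam + 1))) := by
  obtain ⟨B, hB0, hB⟩ := exists_common_den_pow_dvd P hdeg
  set d := (P (Fin.last n)).natDegree with hd
  have hd1 : (1 : ℝ) ≤ d := by exact_mod_cast hdeg (Fin.last n)
  have hlim : Tendsto (fun κ : ℝ => ENNReal.ofReal (2 / (d * (κ + 1)))) (𝓝[<] lam)
      (𝓝 (ENNReal.ofReal (2 / (d * (lam + 1))))) := by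
    refine ENNReal.tendsto_ofReal (Tendsto.mono_left (ContinuousAt.tendsto ?_) nhdsWithin_le_nhds)
    have hlam0 : 0 < lam := lt_of_le_of_lt (Nat.cast_nonneg _) hlam
    have : (d : ℝ) * (lam + 1) ≠ 0 := by positivity
    fun_prop (disch := assumption)
  refine ge_of_tendsto hlim ?_
  filter_upwards [Ioo_mem_nhdsLT hlam] with κ hκ
  have hκ0 : 0 < κ := lt_of_le_of_lt (Nat.cast_nonneg _) hκ.1
  exact (dimH_mono fun x hx =>
    mem_approxSet_of_curvePoint_mem hP ht hd.symm hB0 hB hκ.1 hκ.2 hx).trans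
      (dimH_approxSet_le (C := (B : ℝ) ^ (κ + 1)) (by positivity) (by positivity))

theorem le_dimH_preimage_curvePoint {k d : ℕ} {P : Fin k → ℚ[X]}
    (hd : ∀ j, (P j).natDegree ≤ d) (hd1 : 1 ≤ d) {lam : ℝ} (hlam : 1 < lam) :
    ENNReal.ofReal (2 / (d * (lam + 1))) ≤ dimH (curvePoint P ⁻¹' simApprox k lam) := by
  have hd1' : (1 : ℝ) ≤ d := by exact_mod_cast hd1
  have hsub : approxSet 1 (d * (lam + 1)) ⊆
      Set.range ((↑) : ℚ → ℝ) ∪ curvePoint P ⁻¹' simApprox k lam := fun x hx => by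
    by_cases hirr : Irrational x
    · exact Or.inr (curvePoint_mem_simApprox P hd hd1 (by linarith) hirr hx)
    · left; simpa [Irrational] using hirr
  refine (le_dimH_approxSet (by nlinarith)).trans ((dimH_mono hsub).trans ?_)
  rw [dimH_union, dimH_countable (Set.countable_range _)]
  exact max_le bot_le le_rfl

end PolyCurve

theorem corollary2p2 (n : ℕ) (P : Fin (n + 1) → Polynomial ℚ)
    (hP : P 0 = Polynomial.X)
    (hd : Monotone (PolyCurve.type P))
    (ht : 1 ≤ PolyCurve.diameter P)
    (lam : ℝ) (hlam : (PolyCurve.diameter P : ℝ) < lam) :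
    dimH (PolyCurve.curve P ∩ PolyCurve.simApprox (n + 1) lam) =
      ENNReal.ofReal (2 / ((PolyCurve.type P (Fin.last n) : ℝ) * (lam + 1))) := by
  have hdeg : ∀ j, 1 ≤ (P j).natDegree := fun j => by
    have h := hd (Fin.zero_le j)
    simpa [PolyCurve.type, hP] using h
  have hstep : ∀ j : Fin n,
      (P j.succ).natDegree ≤ (P j.castSucc).natDegree + PolyCurve.diameter P := fun j => by
    have h : PolyCurve.type P j.succ - PolyCurve.type P j.castSucc ≤ PolyCurve.diameter P :=
      Finset.le_sup (f := fun j : Fin n => PolyCurve.type P j.succ - PolyCurve.type P j.castSucc)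
        (Finset.mem_univ j)
    simp only [PolyCurve.type] at h
    omega
  have hlam1 : 1 < lam := lt_of_le_of_lt (by exact_mod_cast ht) hlam
  have himage : PolyCurve.curve P ∩ PolyCurve.simApprox (n + 1) lam =
      PolyCurve.curvePoint P '' (PolyCurve.curvePoint P ⁻¹' PolyCurve.simApprox (n + 1) lam) := by
    rw [Set.image_preimage_eq_range_inter]; rfl
  rw [himage, PolyCurve.dimH_image_curvePoint hP]
  exact le_antisymm (PolyCurve.dimH_preimage_curvePoint_le hP hdeg hstep hlam)
    (PolyCurve.le_dimH_preimage_curvePoint (fun j => hd (Fin.le_last j)) (hdeg _) hlam1)
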